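/- Fix a field $\mathbb{k}$. A persistence module is a functor $M\colon(\mathbb{R},\leq)\to\mathbf{Vect}_{\mathbb{k}}$; these form an abelian category with enough projectives. For $-\infty<a<b\leq\infty$ let $\mathbb{k}[a,b)$ denote the interval module, equal to $\mathbb{k}$ on $[a,b)$ with identity structure maps there, and $0$ elsewhere. A persistence module is finitely presented if it is isomorphic to the cokernel of a morphism $\bigoplus_{j=1}^n\mathbb{k}[d_j,\infty)\to\bigoplus_{i=1}^m\mathbb{k}[c_i,\infty)$ with $m,n$ finite. A finitely presented persistence module $M$ has a barcode decomposition $M\cong\bigoplus_{i=1}^{n}\mathbb{k}[a_i,b_i)$, unique up to order, and its persistent magnitude is $$|M|=\sum_{i=1}^n\left(e^{-a_i}-e^{-b_i}\right),\qquad e^{-\infty}:=0.$$ The tensor product of persistence modules is $$(M\otimes N)(s)=\operatorname*{colim}_{s_1+s_2\leq s}M(s_1)\otimes_{\mathbb{k}} N(s_2),$$ and $\operatorname{Tor}_i(M,-)$ denotes the $i$-th left derived functor of $M\otimes-$. Let $M$ and $N$ be finitely presented persistence modules. Then $M\otimes N$ and all $\operatorname{Tor}_i(M,N)$, $i\ge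 0$, are finitely presented, and $$|M|\cdot|N|=|M\otimes N|-|\operatorname{Tor}_1(M,N)|.$$ Moreover $\operatorname{Tor}_i(M,N)=0$ for $i\geq 2$, so that persistent magnitude is multiplicative for the derived tensor product: $$|M|\cdot|N|=\sum_{i=0}^\infty(-1)^i\,|\operatorname{Tor}_i(M,N)|.$$ -/

import Mathlib

open CategoryTheory CategoryTheory.Limits CategoryTheory.MonoidalCategory

universe u

noncomputable section

namespace Persistence

/-- Persistence modules over `k`: functors from the ordered set `(ℝ, ≤)` to `k`-vector spaces. -/
abbrev PersMod (k : Type u) [Field k] := ℝ ⥤ ModuleCat.{u} k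

section Intervals

variable (k : Type u) [Field k]

/-- The value of the interval module `kJ` at `x`, as a subspace of `k`: all of `k` if `x ∈ J`,
and `0` otherwise. -/
def intervalSpace (J : Set ℝ) (x : ℝ) : Submodule k k where
  carrier := {c | x ∉ J → c = 0}
  add_mem' := by
    intro c d hc hd hx
    simp [hc hx, hd hx]
  zero_mem' := fun _ => rfl
  smul_mem' := by
    intro r c hc hx
    simp [hc hx]

open Classical in
/-- The structure map of `kJ` from `x` to `y`: the identity of `k` if `x, y ∈ J`, otherwise `0`
(if `x ∉ J` then the source is already `0`). -/
def intervalMap (J : Set ℝ) (x y : ℝ) : intervalSpace k J x →ₗ[k] intervalSpace k J y where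
  toFun c := ⟨if y ∈ J then c.1 else 0, fun hy => if_neg hy⟩
  map_add' := by
    intro c d
    ext
    by_cases hy : y ∈ J <;> simp [hy]
  map_smul' := by
    intro r c
    ext
    by_cases hy : y ∈ J <;> simp [hy]

/-- The interval module `kJ` of an interval `J ⊆ ℝ`. -/
def intervalModule (J : Set ℝ) (hJ : J.OrdConnected) : PersMod k where
  obj x := ModuleCat.of k (intervalSpace k J x)
  map {x y} _ := ModuleCat.ofHom (intervalMap k J x y)
  map_id x := by
    ext c
    by_cases hx : x ∈ J
    · simp [intervalMap, hx]
    · have := c.2 hx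
      simp [intervalMap, hx, this]
  map_comp {x y z} f g := by
    ext c
    by_cases hz : z ∈ J
    · by_cases hy : y ∈ J
      · simp [intervalMap, hy, hz]
      · have hx : x ∉ J := fun hx => hy (hJ.out hx hz ⟨leOfHom f, leOfHom g⟩)
        have := c.2 hx
        simp [intervalMap, hy, hz, this]
    · simp [intervalMap, hz]

/-- The free persistence module `k[a,∞)` on one generator in degree `a`. -/
abbrev freeModule (a : ℝ) : PersMod k := intervalModule k (Set.Ici a) Set.ordConnected_Ici

/-- The half-open interval `[a,b)`, where `b = ∞` is allowed. -/
def halfOpen (a : ℝ) (b : WithTop ℝ) : Set ℝ := {x | a ≤ x ∧ (x : WithTop ℝ) < b}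

theorem ordConnected_halfOpen (a : ℝ) (b : WithTop ℝ) : (halfOpen a b).OrdConnected :=
  ⟨fun _ hx _ hy _ hz =>
    ⟨hx.1.trans hz.1, lt_of_le_of_lt (WithTop.coe_le_coe.mpr hz.2) hy.2⟩⟩

end Intervals

/-- A bar `[a,b)` with `-∞ < a < b ≤ ∞`. -/
structure Bar where
  birth : ℝ
  death : WithTop ℝ
  lt : (birth : WithTop ℝ) < death

/-- The interval module `k[a,b)` of a bar. -/
def Bar.module (k : Type u) [Field k] (β : Bar) : PersMod k :=
  intervalModule k (halfOpen β.birth β.death) (ordConnected_halfOpen β.birth β.death)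

/-- `e^{-b}`, with the convention `e^{-∞} = 0`. -/
def expNeg : WithTop ℝ → ℝ
  | none => 0
  | some b => Real.exp (-b)

/-- The weight `e^{-a} - e^{-b}` of a bar `[a,b)`. -/
def Bar.weight (β : Bar) : ℝ := Real.exp (-β.birth) - expNeg β.death

section Magnitude

variable {k : Type u} [Field k]

instance hasFiniteBiproducts_persMod : HasFiniteBiproducts (PersMod k) :=
  Abelian.hasFiniteBiproducts

/-- `M` is finitely presented: it has finitely many generators and finitely many relations, i.e.
it is the cokernel of a map between finite direct sums of modules `k[a,∞)`. -/
def IsFinitelyPresented (M : PersMod k) : Prop :=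
  ∃ (m n : ℕ) (a : Fin m → ℝ) (b : Fin n → ℝ)
    (f : (⨁ fun j => freeModule k (b j)) ⟶ (⨁ fun i => freeModule k (a i))),
    Nonempty (M ≅ cokernel f)

/-- `B` is a (finite) barcode decomposition of `M`. -/
def IsBarcode (M : PersMod k) (B : List Bar) : Prop :=
  Nonempty (M ≅ ⨁ fun i : Fin B.length => (B.get i).module k)

open Classical in
/-- The magnitude `|M| = ∑ (e^{-a_i} - e^{-b_i})`, the sum being over a barcode decomposition
`M ≅ ⨁ k[a_i,b_i)`. (The value is only meaningful if such a decomposition exists.) -/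
def magnitude (M : PersMod k) : ℝ :=
  if h : ∃ B : List Bar, IsBarcode M B then (h.choose.map Bar.weight).sum else 0

end Magnitude

section Tensor

variable {k : Type u} [Field k]

/-- Addition as a functor `(s₁, s₂) ↦ s₁ + s₂`. An object of `CostructuredArrow addFunctor s` is a
pair `(s₁, s₂)` with `s₁ + s₂ ≤ s`. -/
def addFunctor : ℝ × ℝ ⥤ ℝ where
  obj p := p.1 + p.2
  map f := homOfLE (add_le_add (leOfHom f.1) (leOfHom f.2))

/-- The functor `(s₁, s₂) ↦ M(s₁) ⊗ N(s₂)`. -/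
def external (M N : PersMod k) : ℝ × ℝ ⥤ ModuleCat.{u} k where
  obj p := M.obj p.1 ⊗ N.obj p.2
  map f := M.map f.1 ⊗ₘ N.map f.2

/-- The transformation `M(s₁) ⊗ N(s₂) ⟶ M(s₁) ⊗ N'(s₂)` induced by `N ⟶ N'`. -/
def externalMap (M : PersMod k) {N N' : PersMod k} (g : N ⟶ N') :
    external M N ⟶ external M N' where
  app p := M.obj p.1 ◁ g.app p.2
  naturality p q f := by
    change (M.map f.1 ⊗ₘ N.map f.2) ≫ M.obj q.1 ◁ g.app q.2 =
      M.obj p.1 ◁ g.app p.2 ≫ (M.map f.1 ⊗ₘ N'.map f.2)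
    rw [MonoidalCategory.tensorHom_def, MonoidalCategory.tensorHom_def, Category.assoc,
      ← MonoidalCategory.whiskerLeft_comp, NatTrans.naturality,
      MonoidalCategory.whiskerLeft_comp, whisker_exchange_assoc]

/-- The tensor product of persistence modules: `(M ⊗ N)(s)` is the colimit of `M(s₁) ⊗ N(s₂)`
over the pairs with `s₁ + s₂ ≤ s`. -/
def tensor (M N : PersMod k) : PersMod k :=
  addFunctor.pointwiseLeftKanExtension (external M N)

theorem tensor_obj (M N : PersMod k) (s : ℝ) :
    (tensor M N).obj s = colimit (CostructuredArrow.proj addFunctor s ⋙ external M N) := rfl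

/-- The map `M ⊗ N ⟶ M ⊗ N'` induced by `N ⟶ N'`, at `s`. -/
def tensorMapApp (M : PersMod k) {N N' : PersMod k} (g : N ⟶ N') (s : ℝ) :
    (tensor M N).obj s ⟶ (tensor M N').obj s :=
  colimMap (Functor.whiskerLeft (CostructuredArrow.proj addFunctor s) (externalMap M g))

/-- The structure map `M(s₁) ⊗ N(s₂) ⟶ (M ⊗ N)(s)` for a pair with `s₁ + s₂ ≤ s`. -/
def tensorι (M N : PersMod k) {s : ℝ} (j : CostructuredArrow addFunctor s) :
    M.obj j.left.1 ⊗ N.obj j.left.2 ⟶ (tensor M N).obj s :=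
  colimit.ι (CostructuredArrow.proj addFunctor s ⋙ external M N) j

theorem tensor_hom_ext {M N : PersMod k} {s : ℝ} {X : ModuleCat.{u} k}
    {f g : (tensor M N).obj s ⟶ X} (h : ∀ j, tensorι M N j ≫ f = tensorι M N j ≫ g) : f = g :=
  colimit.hom_ext h

theorem tensorι_map (M N : PersMod k) {s t : ℝ} (j : CostructuredArrow addFunctor s)
    (f : s ⟶ t) : tensorι M N j ≫ (tensor M N).map f =
      tensorι M N ((CostructuredArrow.map f).obj j) :=
  colimit.ι_desc _ _

theorem tensorι_mapApp (M : PersMod k) {N N' : PersMod k} (g : N ⟶ N') {s : ℝ}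
    (j : CostructuredArrow addFunctor s) : tensorι M N j ≫ tensorMapApp M g s =
      M.obj j.left.1 ◁ g.app j.left.2 ≫ tensorι M N' j :=
  ι_colimMap _ _

/-- The functor `M ⊗ -`. -/
def tensoring (M : PersMod k) : PersMod k ⥤ PersMod k where
  obj N := tensor M N
  map {N N'} g :=
    { app := tensorMapApp M g
      naturality := fun s t f => tensor_hom_ext fun j => by
        rw [← Category.assoc, tensorι_map, tensorι_mapApp, ← Category.assoc, tensorι_mapApp,
          Category.assoc, tensorι_map]
        rfl }
  map_id N := by
    ext1; ext1 s
    refine tensor_hom_ext fun j => ?_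
    rw [tensorι_mapApp, NatTrans.id_app, NatTrans.id_app, MonoidalCategory.whiskerLeft_id,
      Category.id_comp, Category.comp_id]
  map_comp f g := by
    ext1; ext1 s
    refine tensor_hom_ext fun j => ?_
    rw [tensorι_mapApp, NatTrans.comp_app, NatTrans.comp_app, MonoidalCategory.whiskerLeft_comp,
      ← Category.assoc, tensorι_mapApp, Category.assoc, Category.assoc, tensorι_mapApp]

instance additive_tensoring (M : PersMod k) : (tensoring M).Additive where
  map_add {N N' f g} := by
    ext1; ext1 s
    refine tensor_hom_ext fun j => ?_
    change tensorι M N j ≫ tensorMapApp M (f + g) s =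
      tensorι M N j ≫ (tensorMapApp M f s + tensorMapApp M g s)
    rw [Preadditive.comp_add, tensorι_mapApp, tensorι_mapApp, tensorι_mapApp,
      NatTrans.app_add, MonoidalPreadditive.whiskerLeft_add, Preadditive.add_comp]

end Tensor

section Tor

variable {k : Type u} [Field k]

theorem projective_coproduct {C : Type*} [Category* C] {β : Type*} (g : β → C) [HasCoproduct g]
    (h : ∀ b, Projective (g b)) : Projective (∐ g) where
  factors f e _ := by
    refine ⟨Sigma.desc fun b => Projective.factorThru (Sigma.ι g b ≫ f) e, ?_⟩
    refine Sigma.hom_ext _ _ fun b => ?_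
    rw [← Category.assoc, Sigma.ι_desc, Projective.factorThru_comp]

/-- The category of persistence modules has enough projectives, so that derived functors exist. -/
instance enoughProjectives_persMod : EnoughProjectives (PersMod k) where
  presentation M := by
    have hp : ∀ s : ℝ, Projective ((evaluationLeftAdjoint (ModuleCat.{u} k) s).obj
        (Projective.over (M.obj s))) := fun s =>
      (evaluationAdjunctionRight (ModuleCat.{u} k) s).map_projective _ inferInstance
    let p : ∀ s : ℝ, (evaluationLeftAdjoint (ModuleCat.{u} k) s).obj
        (Projective.over (M.obj s)) ⟶ M := fun s =>
      ((evaluationAdjunctionRight (ModuleCat.{u} k) s).homEquiv _ _).symm (Projective.π (M.obj s))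
    have hepi : Epi (Sigma.desc p) := by
      rw [NatTrans.epi_iff_epi_app]
      intro s
      have h : ((evaluationAdjunctionRight (ModuleCat.{u} k) s).unit.app _ ≫
          (Sigma.ι (fun s : ℝ => (evaluationLeftAdjoint (ModuleCat.{u} k) s).obj
            (Projective.over (M.obj s))) s).app s) ≫ (Sigma.desc p).app s =
          Projective.π (M.obj s) := by
        rw [Category.assoc, ← NatTrans.comp_app, Sigma.ι_desc]
        exact ((evaluationAdjunctionRight (ModuleCat.{u} k) s).homEquiv _ _).apply_symm_apply _
      exact epi_of_epi_fac h
    have hproj : Projective (∐ fun s : ℝ => (evaluationLeftAdjoint (ModuleCat.{u} k) s).obj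
        (Projective.over (M.obj s))) :=
      projective_coproduct _ hp
    exact ⟨{ p := ∐ fun s : ℝ => (evaluationLeftAdjoint (ModuleCat.{u} k) s).obj
               (Projective.over (M.obj s))
             projective := hproj
             f := Sigma.desc p
             epi := hepi }⟩

/-- `Tor_i(M, N)`: the `i`-th left derived functor of `M ⊗ -`, evaluated at `N`. -/
def tor (i : ℕ) (M N : PersMod k) : PersMod k := ((tensoring M).leftDerived i).obj N

end Tor

end Persistence

end

/-!
Finitely presented modules are the tame ones: finite-dimensional at every point, zero far to the
left, and locally constant away from finitely many degrees. A tame module is a finite direct sum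
of bars, so its magnitude is `∫ dim M(x) e^{-x} dx`, which makes magnitude additive on short exact
sequences. Structure maps of a free module are injective, so no bar of a submodule can die; hence
tame submodules of finite free modules are free and every tame `N` has a free resolution
`0 → F₁ → F₀ → N → 0`, whence `Tor_i(M, N) = 0` for `i ≥ 2`. Finally `M ⊗ k[a,∞)` is the translate
of `M` by `a`, of magnitude `|M| e^{-a}`, so `|M ⊗ F| = |M| |F|` for `F` finite free, and the exact
sequence `0 → Tor₁(M, N) → M ⊗ F₁ → M ⊗ F₀ → M ⊗ N → 0` gives
`|M ⊗ N| - |Tor₁(M, N)| = |M| (|F₀| - |F₁|) = |M| |N|`.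
-/

noncomputable section

namespace Persistence

section LeftDerived

open HomologicalComplex

variable {C : Type*} [Category* C] [Abelian C] (S : ShortComplex C)

/-- The complex `S.X₁ ⟶ S.X₂` in degrees `1` and `0`, which resolves `S.X₃` when `S` is short
exact. -/
def twoTermComplex : ChainComplex C ℕ := double S.f (ComplexShape.down_mk 1 0 rfl)

/-- The degree `1` part of the two-term complex. -/
def twoTermXOneIso : (twoTermComplex S).X 1 ≅ S.X₁ := doubleXIso₀ S.f _

/-- The degree `0` part of the two-term complex. -/
def twoTermXZeroIso : (twoTermComplex S).X 0 ≅ S.X₂ := doubleXIso₁ S.f _ one_ne_zero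

theorem isZero_twoTermComplex_X (n : ℕ) : IsZero ((twoTermComplex S).X (n + 2)) :=
  isZero_double_X _ _ _ (by simp) (by simp)

theorem twoTermComplex_d_comp :
    (twoTermComplex S).d 1 0 ≫ (twoTermXZeroIso S).hom = (twoTermXOneIso S).hom ≫ S.f := by
  simp [twoTermComplex, twoTermXZeroIso, twoTermXOneIso, double_d]

/-- The augmentation `S.X₂ ⟶ S.X₃` of the two-term complex. -/
def twoTermAugmentation : twoTermComplex S ⟶ (ChainComplex.single₀ C).obj S.X₃ :=
  (ChainComplex.toSingle₀Equiv _ _).symm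
    ⟨(twoTermXZeroIso S).hom ≫ S.g, by
      rw [← Category.assoc, twoTermComplex_d_comp, Category.assoc, S.zero, comp_zero]⟩

theorem twoTermAugmentation_f_zero :
    (twoTermAugmentation S).f 0 = (twoTermXZeroIso S).hom ≫ S.g :=
  ChainComplex.toSingle₀Equiv_symm_apply_f_zero _ _

variable {S}

theorem exactAt_twoTermComplex_succ [Mono S.f] (n : ℕ) :
    (twoTermComplex S).ExactAt (n + 1) := by
  rw [exactAt_iff' _ (n + 2) (n + 1) n (by simp) (by simp)]
  match n with
  | 0 =>
    refine (ShortComplex.exact_iff_mono _ ((isZero_twoTermComplex_X S 0).eq_of_src _ _)).2 ?_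
    have : Mono ((twoTermComplex S).d 1 0 ≫ (twoTermXZeroIso S).hom) :=
      twoTermComplex_d_comp S ▸ mono_comp _ _
    exact mono_of_mono ((twoTermComplex S).d 1 0) (twoTermXZeroIso S).hom
  | n + 1 => exact ShortComplex.exact_of_isZero_X₂ _ (isZero_twoTermComplex_X S n)

theorem quasiIso_twoTermAugmentation (hS : S.ShortExact) : QuasiIso (twoTermAugmentation S) where
  quasiIsoAt n := by
    cases n with
    | zero =>
      have d_zero : (twoTermComplex S).d 0 0 = 0 := shape _ _ _ (by simp)
      rw [ChainComplex.quasiIsoAt₀_iff, ShortComplex.quasiIso_iff_of_zeros' _ d_zero rfl rfl]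
      refine (ShortComplex.exact_and_epi_g_iff_of_iso ?_).2 ⟨hS.exact, hS.epi_g⟩
      refine ShortComplex.isoMk (twoTermXOneIso S) (twoTermXZeroIso S) (Iso.refl _) ?_ ?_
      · exact (twoTermComplex_d_comp S).symm
      · exact (twoTermAugmentation_f_zero S).symm.trans (Category.comp_id _).symm
    | succ n =>
      have := hS.mono_f
      rw [quasiIsoAt_iff_exactAt' _ _ (ChainComplex.exactAt_succ_single_obj _ _)]
      exact exactAt_twoTermComplex_succ n

/-- A short exact sequence with `S.X₁` and `S.X₂` projective, as a projective resolution. -/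
def twoTermResolution (hS : S.ShortExact) [Projective S.X₁] [Projective S.X₂] :
    ProjectiveResolution S.X₃ where
  complex := twoTermComplex S
  projective
    | 0 => .of_iso (twoTermXZeroIso S).symm ‹_›
    | 1 => .of_iso (twoTermXOneIso S).symm ‹_›
    | n + 2 => (isZero_twoTermComplex_X S n).projective
  π := twoTermAugmentation S
  quasiIso := quasiIso_twoTermAugmentation hS

variable {D : Type*} [Category* D] [Abelian D] [EnoughProjectives C] (F : C ⥤ D) [F.Additive]

theorem isZero_leftDerived_of_shortExact (hS : S.ShortExact) [Projective S.X₁]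
    [Projective S.X₂] (n : ℕ) : IsZero ((F.leftDerived (n + 2)).obj S.X₃) := by
  refine .of_iso (ExactAt.isZero_homology ?_) ((twoTermResolution hS).isoLeftDerivedObj F (n + 2))
  exact ShortComplex.exact_of_isZero_X₂ _ (F.map_isZero (isZero_twoTermComplex_X S n))

/-- Over a two-term projective resolution, the first left derived functor is a kernel. -/
def leftDerivedOneIsoKernel (hS : S.ShortExact) [Projective S.X₁] [Projective S.X₂] :
    (F.leftDerived 1).obj S.X₃ ≅ kernel (F.map S.f) :=
  let K := (F.mapHomologicalComplex _).obj (twoTermComplex S)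
  have d_two_one : K.d 2 1 = 0 := (F.map_isZero (isZero_twoTermComplex_X S 0)).eq_of_src _ _
  (twoTermResolution hS).isoLeftDerivedObj F 1 ≪≫
    (K.isoHomologyπ 2 1 (by simp) d_two_one).symm ≪≫
    (K.cyclesIsKernel 1 0 (by simp)).conePointUniqueUpToIso (kernelIsKernel (K.d 1 0)) ≪≫
    kernel.mapIso _ _ (F.mapIso (twoTermXOneIso S)) (F.mapIso (twoTermXZeroIso S)) (by
      exact (F.map_comp _ _).symm.trans
        ((congrArg F.map (twoTermComplex_d_comp S)).trans (F.map_comp _ _)))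

/-- The value of a right exact functor on the cokernel term of a short exact sequence. -/
def mapIsoCokernel [PreservesFiniteColimits F] (hS : S.ShortExact) :
    F.obj S.X₃ ≅ cokernel (F.map S.f) :=
  have := hS.epi_g
  (CokernelCofork.mapIsColimit _ hS.exact.gIsCokernel F).coconePointUniqueUpToIso
    (colimit.isColimit (parallelPair (F.map S.f) 0))

end LeftDerived

section FunctorsToModules

variable {C : Type*} [Category* C] {R : Type u} [Ring R] {M N : C ⥤ ModuleCat.{u} R}

theorem app_injective_of_mono (φ : M ⟶ N) [Mono φ] (x : C) : Function.Injective (φ.app x) :=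
  (ModuleCat.mono_iff_injective _).1 inferInstance

theorem app_surjective_of_epi (φ : M ⟶ N) [Epi φ] (x : C) : Function.Surjective (φ.app x) :=
  (ModuleCat.epi_iff_surjective _).1 inferInstance

theorem app_exact {S : ShortComplex (C ⥤ ModuleCat.{u} R)} (hS : S.Exact) (x : C) :
    Function.Exact (S.f.app x) (S.g.app x) :=
  (ShortComplex.ShortExact.moduleCat_exact_iff_function_exact _).1
    (hS.map_of_preservesLeftHomologyOf ((evaluation C (ModuleCat.{u} R)).obj x))

/-- The value of a finite direct sum of functors at a point is the product of their values. -/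
def biproductEquiv {ι : Type} [Finite ι] (f : ι → C ⥤ ModuleCat.{u} R) [HasBiproduct f]
    (x : C) : (⨁ f).obj x ≃ₗ[R] ∀ i, (f i).obj x :=
  ((isBilimitOfPreserves ((evaluation C (ModuleCat.{u} R)).obj x)
    (biproduct.isBilimit f)).isLimit.conePointUniqueUpToIso
      (ModuleCat.HasLimit.productLimitCone _).isLimit).toLinearEquiv

theorem biproductEquiv_apply {ι : Type} [Finite ι] (f : ι → C ⥤ ModuleCat.{u} R) [HasBiproduct f]
    {x : C} (v : (⨁ f).obj x) (i : ι) : biproductEquiv f x v i = (biproduct.π f i).app x v :=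
  rfl

end FunctorsToModules

section Tame

variable {k : Type u} [Field k] {M N : PersMod k} {T : Finset ℝ}

theorem map_map_apply (M : PersMod k) {x y z : ℝ} (f : x ⟶ y) (g : y ⟶ z) (h : x ⟶ z)
    (v : M.obj x) : M.map g (M.map f v) = M.map h v :=
  (ConcreteCategory.congr_hom (M.map_comp f g) v).symm

theorem map_self_apply (M : PersMod k) {x : ℝ} (f : x ⟶ x) (v : M.obj x) : M.map f v = v :=
  ConcreteCategory.congr_hom (M.map_id x) v

/-- `M` is tame with critical values in the finite set `T`: it is pointwise finite-dimensional,
vanishes below `T`, and its structure map from `x` to `y` is bijective whenever no element of `T`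
lies in `(x, y]`. -/
structure TameOn (T : Finset ℝ) (M : PersMod k) : Prop where
  finite : ∀ x, FiniteDimensional k (M.obj x)
  subsingleton : ∀ x, (∀ t ∈ T, x < t) → Subsingleton (M.obj x)
  bijective : ∀ (x y : ℝ) (f : x ⟶ y), (∀ t ∈ T, t ≤ x ∨ y < t) → Function.Bijective (M.map f)

/-- A persistence module is tame if it has finitely many critical values. By
`isFinitelyPresented_iff_tame`, this describes the finitely presented modules through their values
rather than through a presentation. -/
def Tame (M : PersMod k) : Prop := ∃ T, TameOn T M

theorem TameOn.mono {T' : Finset ℝ} (h : TameOn T M) (hT : T ⊆ T') : TameOn T' M where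
  finite := h.finite
  subsingleton x hx := h.subsingleton x fun t ht => hx t (hT ht)
  bijective x y f hf := h.bijective x y f fun t ht => hf t (hT ht)

theorem Tame.exists_common (hM : Tame M) (hN : Tame N) : ∃ T, TameOn T M ∧ TameOn T N := by
  classical
  obtain ⟨T, hT⟩ := hM
  obtain ⟨T', hT'⟩ := hN
  exact ⟨T ∪ T', hT.mono Finset.subset_union_left, hT'.mono Finset.subset_union_right⟩

theorem TameOn.of_iso (hM : TameOn T M) (e : M ≅ N) : TameOn T N := by
  have he (x : ℝ) : Function.Bijective (e.hom.app x) :=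
    ⟨app_injective_of_mono e.hom x, app_surjective_of_epi e.hom x⟩
  refine ⟨fun x => ?_, fun x hx => ?_, fun x y f hf => ?_⟩
  · have := hM.finite x
    exact Module.Finite.of_surjective (e.hom.app x).hom (he x).2
  · have := hM.subsingleton x hx
    exact (he x).2.subsingleton
  · have comm : N.map f ∘ e.hom.app x = e.hom.app y ∘ M.map f :=
      funext fun v => (NatTrans.naturality_apply e.hom f v).symm
    exact ((he x).of_comp_iff _).1 (comm ▸ (he y).comp (hM.bijective x y f hf))

theorem Tame.of_iso (hM : Tame M) (e : M ≅ N) : Tame N :=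
  hM.imp fun _ h => h.of_iso e

theorem TameOn.cokernel (hM : TameOn T M) (hN : TameOn T N) (f : M ⟶ N) :
    TameOn T (cokernel f) := by
  have surj : ∀ x, Function.Surjective ((cokernel.π f).app x) := app_surjective_of_epi _
  have exact_app : ∀ x, Function.Exact (f.app x) ((cokernel.π f).app x) :=
    app_exact (ShortComplex.exact_cokernel f)
  refine ⟨fun x => ?_, fun x hx => ?_, fun x y g hg => ⟨?_, fun c => ?_⟩⟩
  · have := hN.finite x
    exact Module.Finite.of_surjective ((cokernel.π f).app x).hom (surj x)
  · have := hN.subsingleton x hx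
    exact (surj x).subsingleton
  · refine (injective_iff_map_eq_zero _).2 fun c hc => ?_
    obtain ⟨b, rfl⟩ := surj x c
    rw [← NatTrans.naturality_apply] at hc
    obtain ⟨a', ha'⟩ := (exact_app y _).1 hc
    obtain ⟨a, rfl⟩ := (hM.bijective x y g hg).2 a'
    rw [NatTrans.naturality_apply] at ha'
    exact (exact_app x _).2 ⟨a, (hN.bijective x y g hg).1 ha'⟩
  · obtain ⟨b', rfl⟩ := surj y c
    obtain ⟨b, rfl⟩ := (hN.bijective x y g hg).2 b'
    exact ⟨_, (NatTrans.naturality_apply _ g b).symm⟩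

theorem TameOn.kernel (hM : TameOn T M) (hN : TameOn T N) (f : M ⟶ N) : TameOn T (kernel f) := by
  have inj : ∀ x, Function.Injective ((kernel.ι f).app x) := app_injective_of_mono _
  have exact_app : ∀ x, Function.Exact ((kernel.ι f).app x) (f.app x) :=
    app_exact (ShortComplex.exact_kernel f)
  refine ⟨fun x => ?_, fun x hx => ?_, fun x y g hg => ⟨fun c d hcd => ?_, fun c => ?_⟩⟩
  · have := hM.finite x
    exact Module.Finite.of_injective ((kernel.ι f).app x).hom (inj x)
  · have := hM.subsingleton x hx
    exact (inj x).subsingleton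
  · refine inj x ((hM.bijective x y g hg).1 ?_)
    rw [← NatTrans.naturality_apply, ← NatTrans.naturality_apply, hcd]
  · obtain ⟨a, ha⟩ := (hM.bijective x y g hg).2 ((kernel.ι f).app y c)
    have fa_eq_zero : f.app x a = 0 := by
      refine (hN.bijective x y g hg).1 ?_
      rw [← NatTrans.naturality_apply, ha, map_zero]
      exact (exact_app y _).2 ⟨c, rfl⟩
    obtain ⟨d, rfl⟩ := (exact_app x _).1 fa_eq_zero
    refine ⟨d, inj y ?_⟩
    rw [NatTrans.naturality_apply, ha]

theorem Tame.cokernel (hM : Tame M) (hN : Tame N) (f : M ⟶ N) : Tame (cokernel f) := by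
  obtain ⟨T, hM, hN⟩ := hM.exists_common hN
  exact ⟨T, hM.cokernel hN f⟩

theorem Tame.kernel (hM : Tame M) (hN : Tame N) (f : M ⟶ N) : Tame (kernel f) := by
  obtain ⟨T, hM, hN⟩ := hM.exists_common hN
  exact ⟨T, hM.kernel hN f⟩

theorem TameOn.biproduct {ι : Type} [Finite ι] {f : ι → PersMod k}
    (hf : ∀ i, TameOn T (f i)) : TameOn T (⨁ f) := by
  refine ⟨fun x => ?_, fun x hx => ?_, fun x y g hg => ?_⟩
  · have := fun i => (hf i).finite x
    exact Module.Finite.equiv (biproductEquiv f x).symm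
  · have := fun i => (hf i).subsingleton x hx
    exact (biproductEquiv f x).injective.subsingleton
  · have comm : biproductEquiv f y ∘ (⨁ f).map g =
        Pi.map (fun i => (f i).map g) ∘ biproductEquiv f x := by
      funext v i
      simp only [Function.comp_apply, Pi.map_apply, biproductEquiv_apply]
      exact NatTrans.naturality_apply (biproduct.π f i) g v
    refine ((biproductEquiv f y).bijective.of_comp_iff' _).1 ?_
    rw [comm]
    exact (Function.Bijective.piMap fun i => (hf i).bijective x y g hg).comp
      (biproductEquiv f x).bijective

theorem Tame.biproduct {ι : Type} [Finite ι] {f : ι → PersMod k} (hf : ∀ i, Tame (f i)) :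
    Tame (⨁ f) := by
  classical
  have := Fintype.ofFinite ι
  choose T hT using hf
  exact ⟨Finset.univ.biUnion T, TameOn.biproduct fun i =>
    (hT i).mono (Finset.subset_biUnion_of_mem T (Finset.mem_univ i))⟩

end Tame

section IntervalModules

variable {k : Type u} [Field k]

open Classical in
/-- The structure map of `M` from `x` to `y`, extended by zero to pairs with `y < x`. It makes
families of structure maps linear without case distinctions on `x ≤ y`. -/
def mapOrZero (M : PersMod k) (x y : ℝ) : M.obj x →ₗ[k] M.obj y :=
  if h : x ≤ y then (M.map (homOfLE h)).hom else 0

theorem mapOrZero_apply (M : PersMod k) {x y : ℝ} (f : x ⟶ y) (v : M.obj x) :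
    mapOrZero M x y v = M.map f v := by
  rw [mapOrZero, dif_pos (leOfHom f)]
  rfl

variable {J : Set ℝ} {hJ : J.OrdConnected}

/-- The inclusion of the value of an interval module at a point into the ground field. -/
def intervalCoord (hJ : J.OrdConnected) (x : ℝ) : (intervalModule k J hJ).obj x →ₗ[k] k :=
  (intervalSpace k J x).subtype

theorem intervalCoord_injective (x : ℝ) : Function.Injective (intervalCoord (k := k) hJ x) :=
  Subtype.val_injective

theorem intervalCoord_bijective {x : ℝ} (hx : x ∈ J) :
    Function.Bijective (intervalCoord (k := k) hJ x) :=
  ⟨intervalCoord_injective x, fun c => ⟨(⟨c, fun h => absurd hx h⟩ : intervalSpace k J x), rfl⟩⟩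

theorem subsingleton_intervalModule {x : ℝ} (hx : x ∉ J) :
    Subsingleton ((intervalModule k J hJ).obj x) :=
  ⟨fun c d => intervalCoord_injective x ((c.2 hx).trans (d.2 hx).symm)⟩

theorem intervalCoord_map {x y : ℝ} (f : x ⟶ y) (hy : y ∈ J) (c : (intervalModule k J hJ).obj x) :
    intervalCoord hJ y ((intervalModule k J hJ).map f c) = intervalCoord hJ x c :=
  if_pos hy

theorem tameOn_intervalModule {T : Finset ℝ} (below : ∀ x, (∀ t ∈ T, x < t) → x ∉ J)
    (between : ∀ x y : ℝ, x ≤ y → (∀ t ∈ T, t ≤ x ∨ y < t) → (x ∈ J ↔ y ∈ J)) :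
    TameOn T (intervalModule k J hJ) := by
  refine ⟨fun x => ?_, fun x hx => subsingleton_intervalModule (below x hx), fun x y f hf => ?_⟩
  · exact Module.Finite.of_injective _ (intervalCoord_injective x)
  · have mem_iff := between x y (leOfHom f) hf
    by_cases hx : x ∈ J
    · have coord_comp_map : intervalCoord (k := k) hJ y ∘ (intervalModule k J hJ).map f =
          intervalCoord hJ x :=
        funext (intervalCoord_map f (mem_iff.1 hx))
      exact ((intervalCoord_bijective (mem_iff.1 hx)).of_comp_iff' _).1
        (coord_comp_map ▸ intervalCoord_bijective hx)
    · have := subsingleton_intervalModule (k := k) (hJ := hJ) hx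
      have := subsingleton_intervalModule (k := k) (hJ := hJ) (mem_iff.not.1 hx)
      exact ⟨Function.injective_of_subsingleton _, fun c => ⟨0, Subsingleton.elim _ _⟩⟩

theorem tame_freeModule (a : ℝ) : Tame (freeModule k a) := by
  refine ⟨{a}, tameOn_intervalModule (fun x hx => not_le.2 (hx a (Finset.mem_singleton_self a))) ?_⟩
  intro x y hxy hf
  have := hf a (Finset.mem_singleton_self a)
  simp only [Set.mem_Ici]
  grind

variable {a : ℝ}

/-- The element `1` of an interval module in a degree of the interval; it is a generator if the
degree is the least one. -/
def intervalOne (hJ : J.OrdConnected) (ha : a ∈ J) : (intervalModule k J hJ).obj a :=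
  (⟨1, fun h => absurd ha h⟩ : intervalSpace k J a)

theorem intervalCoord_intervalOne (ha : a ∈ J) :
    intervalCoord hJ a (intervalOne (k := k) hJ ha) = 1 := rfl

theorem intervalOne_ne_zero (ha : a ∈ J) : intervalOne (k := k) hJ ha ≠ 0 := fun h =>
  one_ne_zero (congrArg (intervalCoord hJ a) h)

theorem eq_smul_map_intervalOne {x : ℝ} (ha : a ∈ J) (f : a ⟶ x) (hx : x ∈ J)
    (c : (intervalModule k J hJ).obj x) :
    c = intervalCoord hJ x c • (intervalModule k J hJ).map f (intervalOne hJ ha) := by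
  apply intervalCoord_injective
  rw [map_smul, intervalCoord_map f hx, intervalCoord_intervalOne, smul_eq_mul, mul_one]

variable {M : PersMod k}

theorem intervalModule_hom_ext (ha : IsLeast J a) {φ ψ : intervalModule k J hJ ⟶ M}
    (h : φ.app a (intervalOne hJ ha.1) = ψ.app a (intervalOne hJ ha.1)) : φ = ψ := by
  ext x c
  by_cases hx : x ∈ J
  · rw [eq_smul_map_intervalOne ha.1 (homOfLE (ha.2 hx)) hx c, map_smul, map_smul,
      NatTrans.naturality_apply, NatTrans.naturality_apply, h]
  · have := subsingleton_intervalModule (k := k) (hJ := hJ) hx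
    rw [Subsingleton.elim c 0, map_zero, map_zero]

/-- The map from an interval module given by the image `v` of its generator, which has to vanish
outside of the interval. -/
def intervalDesc (hJ : J.OrdConnected) (ha : IsLeast J a) (v : M.obj a)
    (hv : ∀ (x : ℝ) (f : a ⟶ x), x ∉ J → M.map f v = 0) : intervalModule k J hJ ⟶ M where
  app x := ModuleCat.ofHom ((intervalCoord hJ x).smulRight (mapOrZero M a x v))
  naturality x y f := by
    ext c
    change intervalCoord hJ y ((intervalModule k J hJ).map f c) • mapOrZero M a y v =
      M.map f (intervalCoord hJ x c • mapOrZero M a x v)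
    by_cases hx : x ∈ J
    · have g : a ⟶ x := homOfLE (ha.2 hx)
      rw [mapOrZero_apply M g, mapOrZero_apply M (g ≫ f), map_smul, map_map_apply M g f (g ≫ f)]
      by_cases hy : y ∈ J
      · rw [intervalCoord_map f hy]
      · rw [hv y _ hy, smul_zero, smul_zero]
    · have := subsingleton_intervalModule (k := k) (hJ := hJ) hx
      rw [Subsingleton.elim c 0, map_zero, map_zero, map_zero, zero_smul, zero_smul, map_zero]

theorem intervalDesc_app_intervalOne (ha : IsLeast J a) (v : M.obj a)
    (hv : ∀ (x : ℝ) (f : a ⟶ x), x ∉ J → M.map f v = 0) :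
    (intervalDesc hJ ha v hv).app a (intervalOne hJ ha.1) = v := by
  change intervalCoord (k := k) hJ a (intervalOne hJ ha.1) • mapOrZero M a a v = v
  rw [intervalCoord_intervalOne, one_smul, mapOrZero_apply M (𝟙 a), map_self_apply]

/-- The generator of a free module. -/
def freeOne (a : ℝ) : (freeModule k a).obj a := intervalOne Set.ordConnected_Ici Set.self_mem_Ici

theorem freeModule_hom_ext {φ ψ : freeModule k a ⟶ M}
    (h : φ.app a (freeOne a) = ψ.app a (freeOne a)) : φ = ψ :=
  intervalModule_hom_ext isLeast_Ici h

/-- The map from a free module given by the image of its generator. -/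
def freeDesc (v : M.obj a) : freeModule k a ⟶ M :=
  intervalDesc Set.ordConnected_Ici isLeast_Ici v fun _ f h => absurd (leOfHom f) h

theorem freeDesc_app_freeOne (v : M.obj a) : (freeDesc v).app a (freeOne a) = v :=
  intervalDesc_app_intervalOne isLeast_Ici _ _

instance projective_freeModule (a : ℝ) : Projective (freeModule k a) where
  factors {E X} f e _ := by
    obtain ⟨w, hw⟩ := app_surjective_of_epi e a (f.app a (freeOne a))
    refine ⟨freeDesc w, freeModule_hom_ext ?_⟩
    rw [NatTrans.comp_app, ConcreteCategory.comp_apply, freeDesc_app_freeOne, hw]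

end IntervalModules

section FreeCovers

variable {k : Type u} [Field k] {M : PersMod k} {T : Finset ℝ}

variable (k) in
/-- The free persistence module with one generator in each of the finitely many degrees `a i`. -/
abbrev finiteFree {ι : Type} [Finite ι] (a : ι → ℝ) : PersMod k := ⨁ fun i => freeModule k (a i)

theorem tame_finiteFree {ι : Type} [Finite ι] (a : ι → ℝ) : Tame (finiteFree k a) :=
  Tame.biproduct fun i => tame_freeModule (a i)

instance projective_finiteFree {ι : Type} [Finite ι] (a : ι → ℝ) : Projective (finiteFree k a) :=
  Projective.of_iso (biproduct.isoCoproduct _).symm (projective_coproduct _ fun _ => inferInstance)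

theorem epi_desc_freeDesc {ι : Type} [Finite ι] {a : ι → ℝ} (v : ∀ i, M.obj (a i))
    (span_eq_top : ∀ x, Submodule.span k {w | ∃ i, ∃ f : a i ⟶ x, M.map f (v i) = w} = ⊤) :
    Epi (biproduct.desc fun i => freeDesc (v i)) := by
  refine (NatTrans.epi_iff_epi_app _).2 fun x => (ModuleCat.epi_iff_range_eq_top _).2 ?_
  rw [eq_top_iff, ← span_eq_top x, Submodule.span_le]
  rintro _ ⟨i, f, rfl⟩
  have desc_app : (biproduct.desc fun i => freeDesc (v i)).app (a i)
      ((biproduct.ι (fun i => freeModule k (a i)) i).app (a i) (freeOne (a i))) = v i := by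
    rw [← ConcreteCategory.comp_apply, ← NatTrans.comp_app, biproduct.ι_desc, freeDesc_app_freeOne]
  exact ⟨_, (NatTrans.naturality_apply _ f _).trans (congrArg _ desc_app)⟩

theorem TameOn.exists_bijective_map (h : TameOn T M) {x : ℝ} (hx : ∃ t ∈ T, t ≤ x) :
    ∃ t ∈ T, (∀ t' ∈ T, t' ≤ x → t' ≤ t) ∧ ∃ f : t ⟶ x, Function.Bijective (M.map f) := by
  obtain ⟨t, ht, t_max⟩ := (T.filter (· ≤ x)).exists_max_image id
    (by simpa only [Finset.Nonempty, Finset.mem_filter] using hx)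
  simp only [Finset.mem_filter, id, and_imp] at ht t_max
  refine ⟨t, ht.1, t_max, homOfLE ht.2, h.bijective _ _ _ fun t' ht' => ?_⟩
  exact (le_or_gt t' x).imp_left (t_max t' ht')

theorem TameOn.exists_critical (h : TameOn T M) (x : ℝ) [Nontrivial (M.obj x)] :
    ∃ t ∈ T, ∃ f : t ⟶ x, Function.Bijective (M.map f) := by
  have hx : ∃ t ∈ T, t ≤ x := by
    by_contra! hT
    exact not_subsingleton _ (h.subsingleton x hT)
  obtain ⟨t, ht, -, bij⟩ := h.exists_bijective_map hx
  exact ⟨t, ht, bij⟩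

theorem Tame.exists_free_cover (hM : Tame M) :
    ∃ (n : ℕ) (a : Fin n → ℝ) (p : finiteFree k a ⟶ M), Epi p := by
  obtain ⟨T, h⟩ := hM
  have := h.finite
  let I := Σ t : T, Fin (Module.finrank k (M.obj t))
  let e : Fin (Fintype.card I) ≃ I := (Fintype.equivFin I).symm
  let v (i : I) : M.obj i.1 := Module.finBasis k (M.obj i.1) i.2
  refine ⟨_, fun i => (e i).1, _, epi_desc_freeDesc (fun i => v (e i)) fun x => ?_⟩
  rcases subsingleton_or_nontrivial (M.obj x) with hx | hx
  · exact Subsingleton.elim _ _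
  obtain ⟨t, ht, f, hf⟩ := h.exists_critical x
  have range_eq_top : LinearMap.range (M.map f).hom = ⊤ := LinearMap.range_eq_top.2 hf.2
  rw [eq_top_iff, ← range_eq_top, ← Submodule.map_top, ← (Module.finBasis k (M.obj t)).span_eq,
    Submodule.map_span, Submodule.span_le]
  rintro _ ⟨_, ⟨i, rfl⟩, rfl⟩
  obtain ⟨j, hj⟩ := e.surjective ⟨⟨t, ht⟩, i⟩
  refine Submodule.subset_span ⟨j, ?_⟩
  rw [hj]
  exact ⟨f, rfl⟩

end FreeCovers

section IntervalSummands

variable {k : Type u} [Field k] {M : PersMod k} {T : Finset ℝ}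

theorem exists_compatible_dual {ι : Type*} [Preorder ι] [IsDirectedOrder ι] {G : ι → Type*}
    [∀ i, AddCommGroup (G i)] [∀ i, Module k (G i)] (f : ∀ i j, i ≤ j → G i →ₗ[k] G j)
    [DirectedSystem G fun i j h => f i j h] {i : ι} (v : G i)
    (hv : ∀ (j : ι) (h : i ≤ j), f i j h v ≠ 0) :
    ∃ ψ : ∀ j, G j →ₗ[k] k, (∀ (j l : ι) (h : j ≤ l) (w : G j), ψ l (f j l h w) = ψ j w) ∧
      ψ i v = 1 := by
  classical
  have limit_ne_zero : Module.DirectLimit.of k ι G f i v ≠ 0 := fun h0 =>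
    let ⟨j, h, hj⟩ := Module.DirectLimit.of.zero_exact h0
    hv j h hj
  obtain ⟨φ, hφ⟩ := Module.Projective.exists_dual_eq_one k limit_ne_zero
  exact ⟨fun j => φ ∘ₗ Module.DirectLimit.of k ι G f j,
    fun j l h w => congrArg φ Module.DirectLimit.of_f, hφ⟩

variable {J : Set ℝ}

open Classical in
/-- The map to an interval module given by a compatible family of functionals on the interval. -/
def intervalLift (hJ : J.OrdConnected)
    (hM : ∀ x ∉ J, ∀ y ∈ J, x ≤ y → Subsingleton (M.obj x)) (ψ : ∀ x : J, M.obj x →ₗ[k] k)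
    (hψ : ∀ (x y : J) (f : (x : ℝ) ⟶ y) (m : M.obj x), ψ y (M.map f m) = ψ x m) :
    M ⟶ intervalModule k J hJ where
  app x := ModuleCat.ofHom <| LinearMap.codRestrict (intervalSpace k J x)
    (if hx : x ∈ J then ψ ⟨x, hx⟩ else 0) fun m hx => by rw [dif_neg hx, LinearMap.zero_apply]
  naturality x y f := by
    ext m
    by_cases hy : y ∈ J
    · by_cases hx : x ∈ J
      · apply intervalCoord_injective
        refine Eq.trans ?_ (intervalCoord_map f hy _).symm
        change (if hy : y ∈ J then ψ ⟨y, hy⟩ else 0 : M.obj y →ₗ[k] k) (M.map f m) =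
          (if hx : x ∈ J then ψ ⟨x, hx⟩ else 0 : M.obj x →ₗ[k] k) m
        rw [dif_pos hx, dif_pos hy]
        exact hψ ⟨x, hx⟩ ⟨y, hy⟩ f m
      · have := hM x hx y hy (leOfHom f)
        rw [Subsingleton.elim m 0, map_zero, map_zero]
    · have := subsingleton_intervalModule (k := k) (hJ := hJ) hy
      exact Subsingleton.elim _ _

theorem intervalCoord_intervalLift_app {hJ : J.OrdConnected}
    (hM : ∀ x ∉ J, ∀ y ∈ J, x ≤ y → Subsingleton (M.obj x)) (ψ : ∀ x : J, M.obj x →ₗ[k] k)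
    (hψ : ∀ (x y : J) (f : (x : ℝ) ⟶ y) (m : M.obj x), ψ y (M.map f m) = ψ x m)
    (x : J) (m : M.obj x) : intervalCoord hJ x ((intervalLift hJ hM ψ hψ).app x m) = ψ x m :=
  LinearMap.congr_fun (dif_pos x.2) m

variable {a : ℝ}

theorem exists_interval_retract (hJ : J.OrdConnected) (ha : IsLeast J a)
    (hM : ∀ x < a, Subsingleton (M.obj x)) (v : M.obj a)
    (hv : ∀ (x : ℝ) (f : a ⟶ x), M.map f v = 0 ↔ x ∉ J) :
    ∃ (s : intervalModule k J hJ ⟶ M) (r : M ⟶ intervalModule k J hJ), s ≫ r = 𝟙 _ := by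
  have hM' : ∀ x ∉ J, ∀ y ∈ J, x ≤ y → Subsingleton (M.obj x) := fun x hx y hy hxy =>
    hM x <| lt_of_not_ge fun hax => hx (hJ.out ha.1 hy ⟨hax, hxy⟩)
  have : DirectedSystem (fun x : J => M.obj x) fun _ _ h => (M.map (homOfLE h)).hom :=
    ⟨fun _ _ => map_self_apply M _ _, fun _ _ _ _ _ _ => map_map_apply M _ _ _ _⟩
  obtain ⟨ψ, hψ, ψ_v⟩ := exists_compatible_dual (G := fun x : J => M.obj x)
    (fun _ _ h => (M.map (homOfLE h)).hom) (i := ⟨a, ha.1⟩) v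
    fun x h hx => (hv x (homOfLE h)).1 hx x.2
  let s := intervalDesc hJ ha v fun x f => (hv x f).2
  let r := intervalLift hJ hM' ψ fun x y f => hψ x y (leOfHom f)
  refine ⟨s, r, intervalModule_hom_ext ha (intervalCoord_injective a ?_)⟩
  rw [NatTrans.comp_app, ConcreteCategory.comp_apply, intervalDesc_app_intervalOne]
  exact (intervalCoord_intervalLift_app hM' ψ _ ⟨a, ha.1⟩ v).trans ψ_v

theorem TameOn.exists_death (h : TameOn T M) {v : M.obj a} (hv : v ≠ 0) :
    ∃ b : WithTop ℝ, a < b ∧ (∀ d : ℝ, b = d → d ∈ T) ∧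
      ∀ (x : ℝ) (f : a ⟶ x), M.map f v = 0 ↔ b ≤ x := by
  classical
  let D := T.filter fun t => ∃ f : a ⟶ t, M.map f v = 0
  have mem_D {t : ℝ} : t ∈ D ↔ t ∈ T ∧ ∃ f : a ⟶ t, M.map f v = 0 := Finset.mem_filter
  have death_iff (x : ℝ) (f : a ⟶ x) : M.map f v = 0 ↔ D.min ≤ x := by
    refine ⟨fun hx => ?_, fun hx => ?_⟩
    · obtain ⟨t, ht, t_max, g, bij⟩ := (h.mono (Finset.subset_insert a T)).exists_bijective_map
        ⟨a, Finset.mem_insert_self a T, leOfHom f⟩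
      have f' : a ⟶ t := homOfLE (t_max a (Finset.mem_insert_self a T) (leOfHom f))
      have ht0 : M.map f' v = 0 := bij.1 (by rw [map_map_apply M f' g f, hx, map_zero])
      have t_mem : t ∈ T := Finset.mem_of_mem_insert_of_ne ht fun hta => by
        subst hta
        exact hv (by rwa [map_self_apply] at ht0)
      exact (Finset.min_le (mem_D.2 ⟨t_mem, f', ht0⟩)).trans (WithTop.coe_le_coe.2 (leOfHom g))
    · obtain ⟨d, hd⟩ := WithTop.ne_top_iff_exists.1 (ne_top_of_le_ne_top WithTop.coe_ne_top hx)
      obtain ⟨-, g, hg⟩ := mem_D.1 (Finset.mem_of_min hd.symm)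
      have d_le : d ≤ x := WithTop.coe_le_coe.1 (hd ▸ hx)
      rw [← map_map_apply M g (homOfLE d_le) f, hg, map_zero]
  refine ⟨D.min, lt_of_not_ge fun hle => hv ?_,
    fun d hd => (mem_D.1 (Finset.mem_of_min hd)).1, death_iff⟩
  rw [← map_self_apply M (𝟙 a) v, (death_iff a (𝟙 a)).2 hle]

theorem TameOn.exists_lowest (h : TameOn T M) (hM : ∃ x, Nontrivial (M.obj x)) :
    ∃ a ∈ T, Nontrivial (M.obj a) ∧ ∀ x < a, Subsingleton (M.obj x) := by
  classical
  let S := T.filter fun t => Nontrivial (M.obj t)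
  have exists_mem_le (x : ℝ) (hx : Nontrivial (M.obj x)) : ∃ t ∈ S, t ≤ x := by
    obtain ⟨t, ht, f, bij⟩ := h.exists_critical x
    exact ⟨t, Finset.mem_filter.2 ⟨ht, bij.2.nontrivial⟩, leOfHom f⟩
  obtain ⟨x, hx⟩ := hM
  obtain ⟨a, ha, a_min⟩ := S.exists_min_image id ((exists_mem_le x hx).imp fun _ => And.left)
  refine ⟨a, (Finset.mem_filter.1 ha).1, (Finset.mem_filter.1 ha).2, fun y hy => ?_⟩
  by_contra hy'
  obtain ⟨t, ht, hty⟩ := exists_mem_le y (not_subsingleton_iff_nontrivial.1 hy')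
  exact (a_min t ht).not_gt (hty.trans_lt hy)

theorem tameOn_bar (β : Bar) (birth_mem : β.birth ∈ T)
    (death_mem : ∀ d : ℝ, β.death = d → d ∈ T) : TameOn T (β.module k) := by
  refine tameOn_intervalModule (fun x hx hx' => (hx _ birth_mem).not_ge hx'.1)
    fun x y hxy hT => and_congr ?_ ?_
  · have := hT _ birth_mem
    grind
  · induction hd : β.death using WithTop.recTopCoe with
    | top => simp only [WithTop.coe_lt_top]
    | coe d =>
      have := hT d (death_mem d hd)
      simp only [WithTop.coe_lt_coe]
      grind

theorem tame_bar (β : Bar) : Tame (β.module k) :=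
  ⟨{β.birth, β.death.untopD β.birth}, tameOn_bar β (Finset.mem_insert_self _ _) fun d hd => by
    simp [hd]⟩

theorem TameOn.exists_bar_summand (h : TameOn T M) (hM : ∃ x, Nontrivial (M.obj x)) :
    ∃ β : Bar, β.birth ∈ T ∧ TameOn T (β.module k) ∧
      ∃ (s : β.module k ⟶ M) (r : M ⟶ β.module k), s ≫ r = 𝟙 _ := by
  obtain ⟨a, ha, _, below⟩ := h.exists_lowest hM
  obtain ⟨v, hv⟩ := exists_ne (0 : M.obj a)
  obtain ⟨b, hab, b_mem, hb⟩ := h.exists_death hv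
  refine ⟨⟨a, b, hab⟩, ha, tameOn_bar _ ha b_mem,
    exists_interval_retract _ ⟨⟨le_rfl, hab⟩, fun x hx => hx.1⟩ below v fun x f => ?_⟩
  rw [hb x f, ← not_lt]
  exact not_congr (and_iff_right (leOfHom f)).symm

end IntervalSummands

section Barcodes

open Module

/-- Splitting off the first summand of a finite direct sum. -/
def biproductFinSuccIso {C : Type*} [Category* C] [HasZeroMorphisms C] [HasFiniteBiproducts C]
    [HasBinaryBiproducts C] {n : ℕ} (f : Fin (n + 1) → C) :
    ⨁ f ≅ f 0 ⊞ ⨁ fun i : Fin n => f i.succ :=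
  (biproduct.isLimit f).conePointUniqueUpToIso
    (extendFanIsLimit f (biproduct.isLimit _) (BinaryBiproduct.isLimit _ _))

variable {k : Type u} [Field k] {M N : PersMod k} {T : Finset ℝ}

theorem IsBarcode.cons {β : Bar} {B : List Bar} (hN : IsBarcode N B)
    (e : M ≅ β.module k ⊞ N) : IsBarcode M (β :: B) :=
  hN.map fun eN => e ≪≫ biprod.mapIso (Iso.refl _) eN ≪≫
    (biproductFinSuccIso fun i : Fin (β :: B).length => ((β :: B).get i).module k).symm

theorem isBarcode_nil (hM : IsZero M) : IsBarcode M [] :=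
  ⟨hM.iso ((IsZero.iff_id_eq_zero _).2 (biproduct.hom_ext _ _ fun i => i.elim0))⟩

theorem finrank_obj_of_shortExact {C : Type*} [Category* C]
    {S : ShortComplex (C ⥤ ModuleCat.{u} k)} (hS : S.ShortExact) (x : C)
    [FiniteDimensional k (S.X₂.obj x)] :
    finrank k (S.X₂.obj x) = finrank k (S.X₁.obj x) + finrank k (S.X₃.obj x) := by
  have := hS.mono_f
  have := hS.epi_g
  let E := (evaluation C (ModuleCat.{u} k)).obj x
  have : FiniteDimensional k (S.map E).X₁ :=
    Module.Finite.of_injective (S.f.app x).hom (app_injective_of_mono S.f x)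
  have : FiniteDimensional k (S.map E).X₃ :=
    Module.Finite.of_surjective (S.g.app x).hom (app_surjective_of_epi S.g x)
  exact ModuleCat.free_shortExact_finrank_add (hS.map_of_exact E) rfl rfl

theorem finrank_intervalModule {J : Set ℝ} (hJ : J.OrdConnected) (x : ℝ) :
    finrank k ((intervalModule k J hJ).obj x) = J.indicator 1 x := by
  by_cases hx : x ∈ J
  · rw [Set.indicator_of_mem hx, Pi.one_apply, ← finrank_self k]
    exact (LinearEquiv.ofBijective _ (intervalCoord_bijective hx)).finrank_eq
  · have := subsingleton_intervalModule (k := k) (hJ := hJ) hx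
    rw [Set.indicator_of_notMem hx, finrank_zero_of_subsingleton]

theorem TameOn.exists_barcode (h : TameOn T M) : ∃ B, IsBarcode M B := by
  induction hn : ∑ t ∈ T, finrank k (M.obj t) using Nat.strong_induction_on generalizing M with
  | _ n ih =>
    by_cases nontrivial : ∃ x, Nontrivial (M.obj x)
    · obtain ⟨β, birth_mem, hβ, s, r, hsr⟩ := h.exists_bar_summand nontrivial
      let S : ShortComplex (PersMod k) := .mk s (cokernel.π s) (cokernel.condition s)
      have hS : S.Exact := ShortComplex.exact_cokernel s
      let splitting : S.Splitting := .ofExactOfRetraction S hS r hsr inferInstance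
      have := h.finite
      have finrank_add (t : ℝ) : finrank k (M.obj t) =
          finrank k ((β.module k).obj t) + finrank k (S.X₃.obj t) :=
        finrank_obj_of_shortExact splitting.shortExact t
      have finrank_birth : finrank k ((β.module k).obj β.birth) = 1 :=
        (finrank_intervalModule _ _).trans
          (Set.indicator_of_mem (show β.birth ∈ halfOpen _ _ from ⟨le_rfl, β.lt⟩) 1)
      have sum_lt : ∑ t ∈ T, finrank k (S.X₃.obj t) < n := by
        rw [← hn]
        refine Finset.sum_lt_sum (fun t _ => le_add_self.trans (finrank_add t).ge)
          ⟨β.birth, birth_mem, (Nat.lt_one_add_iff.2 le_rfl).trans_eq ?_⟩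
        rw [finrank_add, finrank_birth]
      obtain ⟨B, hB⟩ := ih _ sum_lt (hβ.cokernel h s) rfl
      exact ⟨β :: B, hB.cons splitting.isoBinaryBiproduct⟩
    · simp only [not_exists, not_nontrivial_iff_subsingleton] at nontrivial
      exact ⟨[], isBarcode_nil (Functor.isZero _ fun _ => ModuleCat.isZero_of_subsingleton _)⟩

end Barcodes

section FreeResolutions

variable {k : Type u} [Field k] {M N : PersMod k}

/-- A persistence module is torsion-free if no nonzero element ever dies. -/
def TorsionFree (M : PersMod k) : Prop :=
  ∀ ⦃x y : ℝ⦄ (f : x ⟶ y), Function.Injective (M.map f)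

theorem TorsionFree.of_mono (hN : TorsionFree N) (φ : M ⟶ N) [Mono φ] : TorsionFree M :=
  fun x y f v w hvw => app_injective_of_mono φ x <| hN f <| by
    rw [← NatTrans.naturality_apply, ← NatTrans.naturality_apply, hvw]

theorem torsionFree_freeModule (a : ℝ) : TorsionFree (freeModule k a) := by
  intro x y f v w hvw
  by_cases hx : x ∈ Set.Ici a
  · have hy : y ∈ Set.Ici a := le_trans hx (leOfHom f)
    apply intervalCoord_injective
    rw [← intervalCoord_map f hy, hvw, intervalCoord_map f hy]
  · exact (subsingleton_intervalModule hx).elim v w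

theorem TorsionFree.biproduct {ι : Type} [Finite ι] {f : ι → PersMod k}
    (hf : ∀ i, TorsionFree (f i)) : TorsionFree (⨁ f) :=
  fun x y g v w hvw => (biproductEquiv f x).injective <| funext fun i => hf i g <| by
    rw [biproductEquiv_apply, biproductEquiv_apply, ← NatTrans.naturality_apply, hvw,
      NatTrans.naturality_apply]

theorem Bar.death_eq_top (β : Bar) (hβ : TorsionFree (β.module k)) : β.death = ⊤ := by
  by_contra ne_top
  obtain ⟨d, hd⟩ := WithTop.ne_top_iff_exists.1 ne_top
  have birth_lt : β.birth < d := WithTop.coe_lt_coe.1 (β.lt.trans_eq hd.symm)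
  have : Subsingleton ((β.module k).obj d) :=
    subsingleton_intervalModule fun h => h.2.ne hd
  have := (hβ (homOfLE birth_lt.le)).subsingleton
  exact intervalOne_ne_zero (k := k) (hJ := ordConnected_halfOpen _ _) ⟨le_rfl, β.lt⟩
    (this.elim _ _)

theorem Bar.module_eq_freeModule {β : Bar} (hβ : β.death = ⊤) :
    β.module k = freeModule k β.birth := by
  have : halfOpen β.birth β.death = Set.Ici β.birth :=
    Set.ext fun x => and_iff_left (hβ ▸ WithTop.coe_lt_top x)
  simp only [Bar.module, this]

theorem Tame.exists_iso_finiteFree (hM : Tame M) (torsionFree : TorsionFree M) :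
    ∃ (n : ℕ) (a : Fin n → ℝ), Nonempty (M ≅ finiteFree k a) := by
  obtain ⟨T, hT⟩ := hM
  obtain ⟨B, ⟨e⟩⟩ := hT.exists_barcode
  have death_eq_top (i : Fin B.length) : (B.get i).death = ⊤ :=
    (B.get i).death_eq_top <| torsionFree.of_mono <|
      biproduct.ι (fun i => (B.get i).module k) i ≫ e.inv
  exact ⟨B.length, fun i => (B.get i).birth,
    ⟨e ≪≫ biproduct.mapIso fun i => eqToIso (Bar.module_eq_freeModule (death_eq_top i))⟩⟩

theorem Tame.exists_free_resolution (hM : Tame M) :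
    ∃ (m n : ℕ) (a : Fin m → ℝ) (b : Fin n → ℝ) (f : finiteFree k b ⟶ finiteFree k a)
      (g : finiteFree k a ⟶ M) (h : f ≫ g = 0), (ShortComplex.mk f g h).ShortExact := by
  obtain ⟨m, a, p, _⟩ := hM.exists_free_cover
  have torsionFree : TorsionFree (finiteFree k a) := .biproduct fun i => torsionFree_freeModule _
  obtain ⟨n, b, ⟨e⟩⟩ := ((tame_finiteFree a).kernel hM p).exists_iso_finiteFree
    (torsionFree.of_mono (kernel.ι p))
  have kernel_shortExact : (ShortComplex.mk (kernel.ι p) p (kernel.condition p)).ShortExact :=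
    .mk' (ShortComplex.exact_kernel p) inferInstance inferInstance
  refine ⟨m, n, a, b, e.inv ≫ kernel.ι p, p, by simp,
    ShortComplex.shortExact_of_iso ?_ kernel_shortExact⟩
  exact ShortComplex.isoMk e (Iso.refl _) (Iso.refl _) (by simp) (by simp)

theorem isFinitelyPresented_iff_tame : IsFinitelyPresented M ↔ Tame M := by
  refine ⟨fun ⟨m, n, a, b, f, ⟨e⟩⟩ => ?_, fun hM => ?_⟩
  · exact ((tame_finiteFree b).cokernel (tame_finiteFree a) f).of_iso e.symm
  · obtain ⟨m, n, a, b, f, g, hfg, hS⟩ := hM.exists_free_resolution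
    have := hS.epi_g
    exact ⟨m, n, a, b, f,
      ⟨hS.exact.gIsCokernel.coconePointUniqueUpToIso (colimit.isColimit _)⟩⟩

end FreeResolutions

section DimensionIntegral

open MeasureTheory Module

variable {k : Type u} [Field k] {M N : PersMod k}

/-- The dimension of `M(x)` weighted by `e^{-x}`, whose integral is the magnitude of `M`. -/
def weightedDim (M : PersMod k) (x : ℝ) : ℝ := finrank k (M.obj x) * Real.exp (-x)

theorem weightedDim_congr (e : M ≅ N) : weightedDim M = weightedDim N := by
  funext x
  rw [weightedDim, weightedDim, (e.app x).toLinearEquiv.finrank_eq]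

theorem Tame.finiteDimensional (hM : Tame M) (x : ℝ) : FiniteDimensional k (M.obj x) :=
  let ⟨_, hT⟩ := hM
  hT.finite x

theorem weightedDim_biproduct {ι : Type} [Fintype ι] {f : ι → PersMod k}
    (hf : ∀ i, Tame (f i)) : weightedDim (⨁ f) = fun x => ∑ i, weightedDim (f i) x := by
  funext x
  have := fun i => (hf i).finiteDimensional x
  simp only [weightedDim]
  rw [(biproductEquiv f x).finrank_eq, finrank_pi_fintype, Nat.cast_sum, Finset.sum_mul]

theorem weightedDim_of_shortExact {S : ShortComplex (PersMod k)} (hS : S.ShortExact)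
    (h₂ : Tame S.X₂) : weightedDim S.X₂ = weightedDim S.X₁ + weightedDim S.X₃ := by
  funext x
  have := h₂.finiteDimensional x
  simp only [weightedDim, Pi.add_apply]
  rw [finrank_obj_of_shortExact hS, Nat.cast_add, add_mul]

theorem weightedDim_intervalModule {J : Set ℝ} (hJ : J.OrdConnected) :
    weightedDim (intervalModule k J hJ) = J.indicator fun x => Real.exp (-x) := by
  funext x
  rw [weightedDim, finrank_intervalModule]
  by_cases hx : x ∈ J
  · simp only [Set.indicator_of_mem hx, Pi.one_apply, Nat.cast_one, one_mul]
  · simp only [Set.indicator_of_notMem hx, Nat.cast_zero, zero_mul]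

theorem integrableOn_Ici_exp_neg (a : ℝ) :
    IntegrableOn (fun x => Real.exp (-x)) (Set.Ici a) := by
  rw [integrableOn_Ici_iff_integrableOn_Ioi]
  exact integrableOn_exp_neg_Ioi a

theorem integral_Ici_exp_neg (a : ℝ) : ∫ x in Set.Ici a, Real.exp (-x) = Real.exp (-a) := by
  rw [integral_Ici_eq_integral_Ioi, integral_exp_neg_Ioi]

theorem setIntegral_halfOpen_exp_neg (β : Bar) :
    ∫ x in halfOpen β.birth β.death, Real.exp (-x) = β.weight := by
  obtain ⟨a, b, hab⟩ := β
  cases b with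
  | top =>
    have halfOpen_eq : halfOpen a ⊤ = Set.Ici a := by simp [halfOpen, Set.Ici]
    change ∫ x in halfOpen a ⊤, Real.exp (-x) = Real.exp (-a) - 0
    rw [halfOpen_eq, integral_Ici_exp_neg, sub_zero]
  | coe d =>
    have halfOpen_eq : halfOpen a d = Set.Ici a \ Set.Ici d := by ext x; simp [halfOpen]
    change ∫ x in halfOpen a d, Real.exp (-x) = Real.exp (-a) - Real.exp (-d)
    rw [halfOpen_eq, setIntegral_sdiff measurableSet_Ici (integrableOn_Ici_exp_neg a)
      (Set.Ici_subset_Ici.2 (WithTop.coe_le_coe.1 hab.le)), integral_Ici_exp_neg,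
      integral_Ici_exp_neg]

theorem integrable_weightedDim_bar (β : Bar) : Integrable (weightedDim (β.module k)) := by
  rw [Bar.module, weightedDim_intervalModule,
    integrable_indicator_iff (ordConnected_halfOpen _ _).measurableSet]
  exact (integrableOn_Ici_exp_neg β.birth).mono_set fun _ hx => hx.1

theorem integral_weightedDim_bar (β : Bar) : ∫ x, weightedDim (β.module k) x = β.weight := by
  rw [Bar.module, weightedDim_intervalModule,
    integral_indicator (ordConnected_halfOpen _ _).measurableSet, setIntegral_halfOpen_exp_neg]

theorem IsBarcode.weightedDim_eq {B : List Bar} (hB : IsBarcode M B) :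
    weightedDim M = fun x => ∑ i : Fin B.length, weightedDim ((B.get i).module k) x :=
  let ⟨e⟩ := hB
  (weightedDim_congr e).trans (weightedDim_biproduct fun _ => tame_bar _)

theorem IsBarcode.integral_weightedDim {B : List Bar} (hB : IsBarcode M B) :
    ∫ x, weightedDim M x = (B.map Bar.weight).sum := by
  rw [hB.weightedDim_eq, integral_finsetSum _ fun i _ => integrable_weightedDim_bar _]
  simp only [integral_weightedDim_bar]
  exact Fin.sum_univ_fun_getElem B Bar.weight

theorem Tame.integrable_weightedDim (hM : Tame M) : Integrable (weightedDim M) := by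
  obtain ⟨T, hT⟩ := hM
  obtain ⟨B, hB⟩ := hT.exists_barcode
  rw [hB.weightedDim_eq]
  exact integrable_finsetSum _ fun i _ => integrable_weightedDim_bar _

theorem Tame.magnitude_eq_integral (hM : Tame M) : magnitude M = ∫ x, weightedDim M x := by
  obtain ⟨T, hT⟩ := hM
  rw [magnitude, dif_pos hT.exists_barcode,
    hT.exists_barcode.choose_spec.integral_weightedDim]

theorem Tame.magnitude_congr (hM : Tame M) (e : M ≅ N) : magnitude M = magnitude N := by
  rw [hM.magnitude_eq_integral, (hM.of_iso e).magnitude_eq_integral, weightedDim_congr e]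

theorem tame_of_isZero (hM : IsZero M) : Tame M := by
  have (x : ℝ) : Subsingleton (M.obj x) :=
    ModuleCat.subsingleton_of_isZero (((evaluation ℝ (ModuleCat.{u} k)).obj x).map_isZero hM)
  exact ⟨∅, fun _ => inferInstance, fun x _ => this x, fun _ _ _ _ =>
    ⟨Function.injective_of_subsingleton _, fun _ => ⟨0, Subsingleton.elim _ _⟩⟩⟩

theorem magnitude_of_isZero (hM : IsZero M) : magnitude M = 0 := by
  rw [(tame_of_isZero hM).magnitude_eq_integral, (isBarcode_nil hM).integral_weightedDim,
    List.map_nil, List.sum_nil]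

theorem magnitude_biproduct {ι : Type} [Fintype ι] {f : ι → PersMod k} (hf : ∀ i, Tame (f i)) :
    magnitude (⨁ f) = ∑ i, magnitude (f i) := by
  rw [(Tame.biproduct hf).magnitude_eq_integral, weightedDim_biproduct hf,
    integral_finsetSum _ fun i _ => (hf i).integrable_weightedDim]
  exact Finset.sum_congr rfl fun i _ => (hf i).magnitude_eq_integral.symm

theorem magnitude_freeModule (a : ℝ) : magnitude (freeModule k a) = Real.exp (-a) := by
  rw [(tame_freeModule a).magnitude_eq_integral, weightedDim_intervalModule,
    integral_indicator measurableSet_Ici, integral_Ici_exp_neg]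

theorem magnitude_of_shortExact {S : ShortComplex (PersMod k)} (hS : S.ShortExact)
    (h₁ : Tame S.X₁) (h₂ : Tame S.X₂) (h₃ : Tame S.X₃) :
    magnitude S.X₂ = magnitude S.X₁ + magnitude S.X₃ := by
  rw [h₁.magnitude_eq_integral, h₂.magnitude_eq_integral, h₃.magnitude_eq_integral,
    weightedDim_of_shortExact hS h₂]
  exact integral_add h₁.integrable_weightedDim h₃.integrable_weightedDim

theorem magnitude_kernel_add (hM : Tame M) (hN : Tame N) (f : M ⟶ N) :
    magnitude (kernel f) + magnitude N = magnitude M + magnitude (cokernel f) := by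
  have tame_kernel := hM.kernel hN f
  have tame_cokernel := hM.cokernel hN f
  have tame_image : Tame (Abelian.image f) := hN.kernel tame_cokernel (cokernel.π f)
  have tame_coimage : Tame (Abelian.coimage f) := tame_kernel.cokernel hM (kernel.ι f)
  have magnitude_M := magnitude_of_shortExact
    (.mk (ShortComplex.exact_cokernel (kernel.ι f))) tame_kernel hM tame_coimage
  have magnitude_N := magnitude_of_shortExact
    (.mk (ShortComplex.exact_kernel (cokernel.π f))) tame_image hN tame_cokernel
  have magnitude_coimage := tame_coimage.magnitude_congr (Abelian.coimageIsoImage f)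
  linarith

end DimensionIntegral

section RightExact

variable {k : Type u} [Field k]

/-- The functor `N ↦ ((s₁, s₂) ↦ M(s₁) ⊗ N(s₂))`, through which `M ⊗ -` factors. -/
def externalFunctor (M : PersMod k) : PersMod k ⥤ ℝ × ℝ ⥤ ModuleCat.{u} k where
  obj N := external M N
  map g := externalMap M g
  map_id N := by
    ext1; ext1 p
    exact MonoidalCategory.whiskerLeft_id _ _
  map_comp f g := by
    ext1; ext1 p
    exact MonoidalCategory.whiskerLeft_comp _ _ _

instance preservesFiniteColimits_externalFunctor (M : PersMod k) :
    PreservesFiniteColimits (externalFunctor M) where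
  preservesFiniteColimits J _ _ := preservesColimitsOfShape_of_evaluation _ J fun p =>
    inferInstanceAs (PreservesColimitsOfShape J
      ((evaluation ℝ (ModuleCat.{u} k)).obj p.2 ⋙ tensorLeft (M.obj p.1)))

instance preservesFiniteColimits_tensoring (M : PersMod k) :
    PreservesFiniteColimits (tensoring M) where
  preservesFiniteColimits J _ _ := preservesColimitsOfShape_of_evaluation _ J fun s =>
    inferInstanceAs (PreservesColimitsOfShape J
      (externalFunctor M ⋙
        (Functor.whiskeringLeft _ _ _).obj (CostructuredArrow.proj addFunctor s) ⋙ colim))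

end RightExact

section PureTensors

variable {k : Type u} [Field k] {M N : PersMod k} {s s₁ s₂ t₁ t₂ : ℝ}

/-- The class in `(M ⊗ N)(s)` of a pure tensor in `M(s₁) ⊗ N(s₂)`, where `s₁ + s₂ ≤ s`, as a
bilinear map. -/
def pureTensor (h : s₁ + s₂ ≤ s) : M.obj s₁ →ₗ[k] N.obj s₂ →ₗ[k] (tensor M N).obj s :=
  (TensorProduct.mk k (M.obj s₁) (N.obj s₂)).compr₂
    (tensorι M N (CostructuredArrow.mk (S := addFunctor) (Y := (s₁, s₂)) (homOfLE h))).hom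

theorem map_pureTensor {t : ℝ} (h : s₁ + s₂ ≤ s) (f : s ⟶ t) (m : M.obj s₁) (n : N.obj s₂) :
    (tensor M N).map f (pureTensor h m n) = pureTensor (h.trans (leOfHom f)) m n :=
  congrArg (fun φ => φ.hom (TensorProduct.tmul k m n)) (tensorι_map M N
    (CostructuredArrow.mk (S := addFunctor) (Y := (s₁, s₂)) (homOfLE h)) f)

theorem pureTensor_map (h : t₁ + t₂ ≤ s) (f : s₁ ⟶ t₁) (g : s₂ ⟶ t₂) (m : M.obj s₁)
    (n : N.obj s₂) : pureTensor h (M.map f m) (N.map g n) =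
      pureTensor ((add_le_add (leOfHom f) (leOfHom g)).trans h) m n := by
  let j : CostructuredArrow addFunctor s := .mk (Y := (s₁, s₂))
    (homOfLE ((add_le_add (leOfHom f) (leOfHom g)).trans h))
  let j' : CostructuredArrow addFunctor s := .mk (Y := (t₁, t₂)) (homOfLE h)
  let φ : j ⟶ j' := CostructuredArrow.homMk (f, g) rfl
  exact congrArg (fun ψ => ψ.hom (TensorProduct.tmul k m n))
    (colimit.w (CostructuredArrow.proj addFunctor s ⋙ external M N) φ)

theorem tensor_hom_ext_pureTensor {X : ModuleCat.{u} k} {f g : (tensor M N).obj s ⟶ X}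
    (h : ∀ (s₁ s₂ : ℝ) (hs : s₁ + s₂ ≤ s) (m : M.obj s₁) (n : N.obj s₂),
      f (pureTensor hs m n) = g (pureTensor hs m n)) : f = g :=
  tensor_hom_ext fun j => ModuleCat.hom_ext <| TensorProduct.ext' fun m n =>
    h j.left.1 j.left.2 (leOfHom j.hom) m n

section Descent

variable {X : ModuleCat.{u} k} (φ : ∀ s₁ s₂ : ℝ, M.obj s₁ →ₗ[k] N.obj s₂ →ₗ[k] X)
  (φ_map : ∀ {s₁ s₂ t₁ t₂ : ℝ} (f : s₁ ⟶ t₁) (g : s₂ ⟶ t₂), t₁ + t₂ ≤ s →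
    ∀ (m : M.obj s₁) (n : N.obj s₂), φ t₁ t₂ (M.map f m) (N.map g n) = φ s₁ s₂ m n)

/-- The cocone under the diagram defining `(M ⊗ N)(s)` given by a compatible family of bilinear
maps on `M(s₁) × N(s₂)`. -/
def bilinearCocone : Cocone (CostructuredArrow.proj addFunctor s ⋙ external M N) where
  pt := X
  ι :=
    { app := fun j => ModuleCat.ofHom (TensorProduct.lift (φ j.left.1 j.left.2))
      naturality := fun _ j' f => ModuleCat.hom_ext <| TensorProduct.ext' fun m n =>
        φ_map f.left.1 f.left.2 (leOfHom j'.hom) m n }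

/-- The map out of `(M ⊗ N)(s)` given by a compatible family of bilinear maps on
`M(s₁) × N(s₂)`. -/
def tensorDesc : (tensor M N).obj s ⟶ X := colimit.desc _ (bilinearCocone φ φ_map)

theorem tensorDesc_pureTensor (h : s₁ + s₂ ≤ s) (m : M.obj s₁) (n : N.obj s₂) :
    tensorDesc φ φ_map (pureTensor h m n) = φ s₁ s₂ m n :=
  congrArg (fun ψ => ψ.hom (TensorProduct.tmul k m n))
    (colimit.ι_desc (bilinearCocone φ φ_map)
      (CostructuredArrow.mk (S := addFunctor) (Y := (s₁, s₂)) (homOfLE h)))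

end Descent

end PureTensors

section TensorFree

variable {k : Type u} [Field k] {M : PersMod k} {a s s₁ s₂ t₁ t₂ : ℝ}

/-- Translation by `-a` on the real line, so that `translation a ⋙ M` is `M` shifted by `a`. -/
def translation (a : ℝ) : ℝ ⥤ ℝ where
  obj s := s - a
  map f := homOfLE (sub_le_sub_right (leOfHom f) a)

variable (M) in
/-- The pairing `M(s₁) × k[a,∞)(s₂) → M(s - a)`. It is zero unless `a ≤ s₂`, so the structure map
of `M` in it may be extended by zero. -/
def freePairing (a s s₁ s₂ : ℝ) :
    M.obj s₁ →ₗ[k] (freeModule k a).obj s₂ →ₗ[k] M.obj (s - a) :=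
  (LinearMap.lsmul k (M.obj (s - a))).flip.compl₁₂ (mapOrZero M s₁ (s - a)) (intervalCoord _ s₂)

theorem freePairing_apply (m : M.obj s₁) (c : (freeModule k a).obj s₂) :
    freePairing M a s s₁ s₂ m c = intervalCoord _ s₂ c • mapOrZero M s₁ (s - a) m := rfl

theorem freePairing_freeOne (m : M.obj s₁) :
    freePairing M a s s₁ a m (freeOne a) = mapOrZero M s₁ (s - a) m := by
  rw [freePairing_apply, freeOne, intervalCoord_intervalOne, one_smul]

theorem freePairing_map (f : s₁ ⟶ t₁) (g : s₂ ⟶ t₂) (h : t₁ + t₂ ≤ s) (m : M.obj s₁)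
    (c : (freeModule k a).obj s₂) :
    freePairing M a s t₁ t₂ (M.map f m) ((freeModule k a).map g c) =
      freePairing M a s s₁ s₂ m c := by
  by_cases ha : s₂ ∈ Set.Ici a
  · have ht₂ : t₂ ∈ Set.Ici a := le_trans ha (leOfHom g)
    have f' : t₁ ⟶ s - a := homOfLE (by linarith [Set.mem_Ici.1 ht₂])
    rw [freePairing_apply, freePairing_apply, intervalCoord_map g ht₂, mapOrZero_apply M f',
      mapOrZero_apply M (f ≫ f'), map_map_apply M f f' (f ≫ f')]
  · have := subsingleton_intervalModule (k := k) (hJ := Set.ordConnected_Ici) ha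
    rw [Subsingleton.elim c 0, map_zero, map_zero, map_zero]

theorem pureTensor_freeModule (h : s₁ + s₂ ≤ s) (m : M.obj s₁) (c : (freeModule k a).obj s₂) :
    pureTensor h m c =
      pureTensor (sub_add_cancel s a).le (freePairing M a s s₁ s₂ m c) (freeOne a) := by
  by_cases ha : s₂ ∈ Set.Ici a
  · have g : a ⟶ s₂ := homOfLE ha
    have f : s₁ ⟶ s - a := homOfLE (by linarith [leOfHom g])
    calc pureTensor h m c
        = pureTensor h (M.map (𝟙 s₁) m)
            ((freeModule k a).map g (intervalCoord _ s₂ c • freeOne a)) := by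
          rw [map_self_apply, map_smul]
          exact congrArg _ (eq_smul_map_intervalOne Set.self_mem_Ici g ha c)
      _ = pureTensor (sub_add_cancel s a).le (M.map f m)
            ((freeModule k a).map (𝟙 a) (intervalCoord _ s₂ c • freeOne a)) := by
          rw [pureTensor_map, pureTensor_map]
      _ = pureTensor (sub_add_cancel s a).le (freePairing M a s s₁ s₂ m c) (freeOne a) := by
          rw [map_self_apply, freePairing_apply, mapOrZero_apply M f, map_smul, map_smul,
            LinearMap.smul_apply]
  · have := subsingleton_intervalModule (k := k) (hJ := Set.ordConnected_Ici) ha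
    rw [Subsingleton.elim c 0, map_zero, map_zero, map_zero, LinearMap.zero_apply]

variable (M) in
/-- The map `m ↦ m ⊗ 1` from `M(s - a)` to `(M ⊗ k[a,∞))(s)`. -/
def tensorOne (a s : ℝ) : M.obj (s - a) ⟶ (tensor M (freeModule k a)).obj s :=
  ModuleCat.ofHom ((pureTensor (sub_add_cancel s a).le).flip (freeOne a))

theorem tensorOne_apply (m : M.obj (s - a)) :
    tensorOne M a s m = pureTensor (sub_add_cancel s a).le m (freeOne a) := rfl

theorem tensorOne_map {t : ℝ} (f : s ⟶ t) (m : M.obj (s - a)) :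
    tensorOne M a t (M.map ((translation a).map f) m) =
      (tensor M (freeModule k a)).map f (tensorOne M a s m) := by
  have h := pureTensor_map (sub_add_cancel t a).le ((translation a).map f) (𝟙 a) m
    (freeOne (k := k) a)
  rw [map_self_apply] at h
  rw [tensorOne_apply, map_pureTensor]
  exact h

theorem tensorOne_comp_tensorDesc :
    tensorOne M a s ≫ tensorDesc (freePairing M a s) freePairing_map = 𝟙 _ := by
  ext m
  rw [ConcreteCategory.comp_apply, tensorOne_apply, tensorDesc_pureTensor, freePairing_freeOne,
    mapOrZero_apply M (𝟙 _), map_self_apply, ConcreteCategory.id_apply]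

theorem tensorDesc_comp_tensorOne :
    tensorDesc (freePairing M a s) freePairing_map ≫ tensorOne M a s = 𝟙 _ :=
  tensor_hom_ext_pureTensor fun s₁ s₂ hs m c => by
    rw [ConcreteCategory.comp_apply, tensorDesc_pureTensor, tensorOne_apply,
      ← pureTensor_freeModule, ConcreteCategory.id_apply]

variable (M) in
/-- Tensoring with `k[a,∞)` translates by `a`. -/
def tensorFreeIso (a : ℝ) : translation a ⋙ M ≅ tensor M (freeModule k a) :=
  NatIso.ofComponents (fun s => ⟨tensorOne M a s, tensorDesc (freePairing M a s) freePairing_map,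
    tensorOne_comp_tensorDesc, tensorDesc_comp_tensorOne⟩) fun f => by
      ext m
      exact tensorOne_map f m

theorem Tame.translation (hM : Tame M) (a : ℝ) : Tame (translation a ⋙ M) := by
  classical
  obtain ⟨T, hT⟩ := hM
  refine ⟨T.image (· + a), fun x => hT.finite _, fun x hx => hT.subsingleton _ fun t ht => ?_,
    fun x y f hf => hT.bijective _ _ _ fun t ht => ?_⟩
  · exact sub_lt_iff_lt_add.2 (hx _ (Finset.mem_image_of_mem _ ht))
  · exact (hf _ (Finset.mem_image_of_mem _ ht)).imp le_sub_iff_add_le.2 sub_lt_iff_lt_add.2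

theorem weightedDim_translation (a x : ℝ) :
    weightedDim (translation a ⋙ M) x = weightedDim M (x - a) * Real.exp (-a) := by
  change (Module.finrank k (M.obj (x - a)) : ℝ) * Real.exp (-x) =
    Module.finrank k (M.obj (x - a)) * Real.exp (-(x - a)) * Real.exp (-a)
  rw [mul_assoc, ← Real.exp_add]
  ring_nf

theorem magnitude_translation (hM : Tame M) (a : ℝ) :
    magnitude (translation a ⋙ M) = magnitude M * Real.exp (-a) := by
  rw [(hM.translation a).magnitude_eq_integral, hM.magnitude_eq_integral]
  simp only [weightedDim_translation]
  rw [MeasureTheory.integral_mul_const, MeasureTheory.integral_sub_right_eq_self]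

variable (M) in
/-- The tensor product with a finite free module is a finite direct sum of translates. -/
def tensorFiniteFreeIso {n : ℕ} (a : Fin n → ℝ) :
    tensor M (finiteFree k a) ≅ ⨁ fun i => translation (a i) ⋙ M :=
  (tensoring M).mapBiproduct _ ≪≫ biproduct.mapIso fun i => (tensorFreeIso M (a i)).symm

theorem Tame.tensor_finiteFree (hM : Tame M) {n : ℕ} (a : Fin n → ℝ) :
    Tame (tensor M (finiteFree k a)) :=
  (Tame.biproduct fun i => hM.translation (a i)).of_iso (tensorFiniteFreeIso M a).symm

theorem magnitude_tensor_finiteFree (hM : Tame M) {n : ℕ} (a : Fin n → ℝ) :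
    magnitude (tensor M (finiteFree k a)) = magnitude M * magnitude (finiteFree k a) := by
  rw [(hM.tensor_finiteFree a).magnitude_congr (tensorFiniteFreeIso M a),
    magnitude_biproduct fun i => hM.translation (a i),
    magnitude_biproduct fun i => tame_freeModule (a i), Finset.mul_sum]
  simp only [magnitude_translation hM, magnitude_freeModule]

end TensorFree

section Tor

variable {k : Type u} [Field k] {M N : PersMod k}

/-- The presentation of `M ⊗ -` of the third term of a short exact sequence, which exists because
`M ⊗ -` is right exact. -/
def tensorIsoCokernel (M : PersMod k) {S : ShortComplex (PersMod k)} (hS : S.ShortExact) :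
    tensor M S.X₃ ≅ cokernel ((tensoring M).map S.f) :=
  mapIsoCokernel (tensoring M) hS

/-- `Tor₁(M, -)` of the third term of a short exact sequence whose first two terms are projective,
as the kernel of the first map tensored with `M`. -/
def torOneIsoKernel (M : PersMod k) {S : ShortComplex (PersMod k)} (hS : S.ShortExact)
    [Projective S.X₁] [Projective S.X₂] : tor 1 M S.X₃ ≅ kernel ((tensoring M).map S.f) :=
  leftDerivedOneIsoKernel (tensoring M) hS

theorem Tame.tensor (hM : Tame M) (hN : Tame N) : Tame (tensor M N) := by
  obtain ⟨m, n, a, b, f, g, h, hS⟩ := hN.exists_free_resolution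
  exact ((hM.tensor_finiteFree b).cokernel (hM.tensor_finiteFree a) _).of_iso
    (tensorIsoCokernel M hS).symm

theorem isZero_tor (M : PersMod k) (hN : Tame N) {i : ℕ} (hi : 2 ≤ i) : IsZero (tor i M N) := by
  obtain ⟨m, n, a, b, f, g, h, hS⟩ := hN.exists_free_resolution
  obtain ⟨i, rfl⟩ := Nat.exists_eq_add_of_le' hi
  exact isZero_leftDerived_of_shortExact (tensoring M) hS i

variable (M N) in
/-- `Tor₀(M, N)` is `M ⊗ N`, since `M ⊗ -` is right exact. -/
def torZeroIso : tor 0 M N ≅ tensor M N := (tensoring M).leftDerivedZeroIsoSelf.app N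

theorem Tame.tor (hM : Tame M) (hN : Tame N) (i : ℕ) : Tame (tor i M N) := by
  match i with
  | 0 => exact (hM.tensor hN).of_iso (torZeroIso M N).symm
  | 1 =>
    obtain ⟨m, n, a, b, f, g, h, hS⟩ := hN.exists_free_resolution
    exact ((hM.tensor_finiteFree b).kernel (hM.tensor_finiteFree a) _).of_iso
      (torOneIsoKernel M hS).symm
  | i + 2 => exact tame_of_isZero (isZero_tor M hN (Nat.le_add_left 2 i))

theorem magnitude_tensor_sub_magnitude_tor {S : ShortComplex (PersMod k)} (hS : S.ShortExact)
    [Projective S.X₁] [Projective S.X₂] (h₁ : Tame (tensor M S.X₁)) (h₂ : Tame (tensor M S.X₂)) :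
    magnitude (tensor M S.X₃) - magnitude (tor 1 M S.X₃) =
      magnitude (tensor M S.X₂) - magnitude (tensor M S.X₁) := by
  let f := (tensoring M).map S.f
  rw [← (h₁.cokernel h₂ f).magnitude_congr (tensorIsoCokernel M hS).symm,
    ← (h₁.kernel h₂ f).magnitude_congr (torOneIsoKernel M hS).symm]
  linear_combination -magnitude_kernel_add h₁ h₂ f

theorem magnitude_mul_magnitude (hM : Tame M) (hN : Tame N) :
    magnitude M * magnitude N = magnitude (tensor M N) - magnitude (tor 1 M N) := by
  obtain ⟨m, n, a, b, f, g, h, hS⟩ := hN.exists_free_resolution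
  have magnitude_resolution :
      magnitude (finiteFree k a) = magnitude (finiteFree k b) + magnitude N :=
    magnitude_of_shortExact hS (tame_finiteFree b) (tame_finiteFree a) hN
  calc magnitude M * magnitude N
      = magnitude M * magnitude (finiteFree k a) - magnitude M * magnitude (finiteFree k b) := by
        rw [magnitude_resolution]
        ring
    _ = magnitude (tensor M (finiteFree k a)) - magnitude (tensor M (finiteFree k b)) := by
        rw [magnitude_tensor_finiteFree hM, magnitude_tensor_finiteFree hM]
    _ = magnitude (tensor M N) - magnitude (tor 1 M N) :=
        (magnitude_tensor_sub_magnitude_tor hS (hM.tensor_finiteFree b)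
          (hM.tensor_finiteFree a)).symm

theorem hasSum_magnitude_tor (hM : Tame M) (hN : Tame N) :
    HasSum (fun i : ℕ => (-1 : ℝ) ^ i * magnitude (tor i M N)) (magnitude M * magnitude N) := by
  have magnitude_tor_zero := (hM.tor hN 0).magnitude_congr (torZeroIso M N)
  have sum_range_two : ∑ i ∈ Finset.range 2, (-1 : ℝ) ^ i * magnitude (tor i M N) =
      magnitude M * magnitude N := by
    rw [magnitude_mul_magnitude hM hN, ← magnitude_tor_zero, Finset.sum_range_succ,
      Finset.sum_range_one]
    ring
  rw [← sum_range_two]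
  refine hasSum_sum_of_ne_finset_zero fun i hi => ?_
  rw [magnitude_of_isZero (isZero_tor M hN (not_lt.1 (Finset.mem_range.not.1 hi))), mul_zero]

end Tor

end Persistence

end

open Persistence in
theorem mainTheorem3 {k : Type u} [Field k] (M N : PersMod k)
    (hM : IsFinitelyPresented M) (hN : IsFinitelyPresented N) :
    (IsFinitelyPresented (tensor M N) ∧ ∀ i : ℕ, IsFinitelyPresented (tor i M N)) ∧
    magnitude M * magnitude N = magnitude (tensor M N) - magnitude (tor 1 M N) ∧
    (∀ i : ℕ, 2 ≤ i → CategoryTheory.Limits.IsZero (tor i M N)) ∧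
    HasSum (fun i : ℕ => (-1 : ℝ) ^ i * magnitude (tor i M N)) (magnitude M * magnitude N) := by
  simp only [isFinitelyPresented_iff_tame] at hM hN ⊢
  exact ⟨⟨hM.tensor hN, hM.tor hN⟩, magnitude_mul_magnitude hM hN, fun _ => isZero_tor M hN,
    hasSum_magnitude_tor hM hN⟩
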